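/- **Theorem 4.4.** Let $R$ be a commutative ring, $\underline{x} = x_1, \dots, x_r$ an ordered sequence of elements of $R$, and $M$ an $R$-module. Write $\underline{x}_i = x_1, \dots, x_i$ for $0 \le i \le r$. The sequence $\underline{x}$ is called $M$-pro-regular if for each $i = 1, \dots, r$ the inverse system $$\bigl\{\bigl((x_1^n, \dots, x_{i-1}^n)M :_M x_i^n\bigr) / (x_1^n, \dots, x_{i-1}^n)M\bigr\}_{n \ge 1},$$ whose transition map from level $m$ to level $n \le m$ is multiplication by $x_i^{m-n}$, is pro-zero, i.e. for each $n \ge 1$ there is an $m \ge n$ such that the transition map from level $m$ to level $n$ is zero. For a sequence $\underline{y} = y_1, \dots, y_k$ in $R$ and an $R$-module $X$ let $\check{H}^1_{\underline{y}}(X) = H^1(\check{C}_{\underline{y}} \otimes_R X)$ be the first Čech cohomology, where $\check{C}_{\underline{y}}$ is the Čech complex of $\underline{y}$, and let $\Gamma_{\underline{y}}(X)$ be the submodule of the elements of $X$ that are annihilated by some power of the ideal $(y_1, \dots, y_k)R$. Then the following conditions are equivalent. (i) The sequence $\underline{x}$ is $M$-pro-regular. (ii) The sequence $\underline{x}$ is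 $(M \otimes_R F)$-pro-regular for every flat $R$-module $F$. (iii) $\check{H}^1_{x_i}\bigl(\Gamma_{\underline{x}_{i-1}}(\operatorname{Hom}_R(M, I))\bigr) = 0$ for $i = 1, \dots, r$ and every injective $R$-module $I$. (iv) $\check{H}^1_{\underline{x}_i}(\operatorname{Hom}_R(M, I)) = 0$ for $i = 1, \dots, r$ and every injective $R$-module $I$. -/

import Mathlib

universe u v w w'

noncomputable section

namespace CechProRegular

open CategoryTheory

variable {R : Type u} [CommRing R]

section ProRegular

/-- An inverse system of modules, indexed by the integers `n ≥ 1`, is pro-zero if for each `n` there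
is `m ≥ n` such that the transition map from level `m` to level `n` is zero. -/
def IsProZero {A : ℕ → Type v} [∀ n, AddCommGroup (A n)] [∀ n, Module R (A n)]
    (φ : ∀ n m : ℕ, n ≤ m → (A m →ₗ[R] A n)) : Prop :=
  ∀ n : ℕ, 1 ≤ n → ∃ (m : ℕ) (h : n ≤ m), φ n m h = 0

variable (M : Type v) [AddCommGroup M] [Module R M]

/-- The submodule `(y₁ⁿ, …, yₖⁿ) M` of `M`. -/
def powSub {k : ℕ} (y : Fin k → R) (n : ℕ) : Submodule R M :=
  Ideal.span (Set.range fun j => y j ^ n) • (⊤ : Submodule R M)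

/-- The colon submodule `(y₁ⁿ, …, yₖⁿ) M :_M aⁿ`. -/
def colonSub {k : ℕ} (y : Fin k → R) (a : R) (n : ℕ) : Submodule R M :=
  (powSub M y n).comap (LinearMap.lsmul R M (a ^ n))

variable {M} in
theorem mem_colonSub {k : ℕ} (y : Fin k → R) (a : R) (n : ℕ) (z : M) :
    z ∈ colonSub M y a n ↔ a ^ n • z ∈ powSub M y n := Iff.rfl

theorem powSub_anti {k : ℕ} (y : Fin k → R) {n m : ℕ} (h : n ≤ m) :
    powSub M y m ≤ powSub M y n := by
  refine Submodule.smul_mono_left (Ideal.span_le.2 ?_)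
  rintro _ ⟨j, rfl⟩
  exact Ideal.mem_of_dvd _ (pow_dvd_pow _ h) (Ideal.subset_span ⟨j, rfl⟩)

/-- The module `((y₁ⁿ, …, yₖⁿ) M :_M aⁿ) / (y₁ⁿ, …, yₖⁿ) M`. -/
abbrev colonQuot {k : ℕ} (y : Fin k → R) (a : R) (n : ℕ) : Type v :=
  colonSub M y a n ⧸ (powSub M y n).submoduleOf (colonSub M y a n)

theorem smul_mem_colonSub {k : ℕ} (y : Fin k → R) (a : R) {n m : ℕ} (h : n ≤ m) (z : M)
    (hz : z ∈ colonSub M y a m) : a ^ (m - n) • z ∈ colonSub M y a n := by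
  rw [mem_colonSub, smul_smul, ← pow_add, Nat.add_sub_cancel' h]
  exact powSub_anti M y h hz

/-- The transition map from level `m` to level `n` (for `n ≤ m`) of the inverse system
`((y₁ⁿ, …, yₖⁿ) M :_M aⁿ) / (y₁ⁿ, …, yₖⁿ) M`: multiplication by `a ^ (m - n)`. -/
def colonTrans {k : ℕ} (y : Fin k → R) (a : R) (n m : ℕ) (h : n ≤ m) :
    colonQuot M y a m →ₗ[R] colonQuot M y a n :=
  Submodule.mapQ _ _
    ((LinearMap.lsmul R M (a ^ (m - n))).restrict (smul_mem_colonSub M y a h))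
    (fun _ hz => Submodule.smul_mem (powSub M y n) _ (powSub_anti M y h hz))

/-- The sequence `x₁, …, x_r` is `M`-pro-regular: for each `i` the inverse system
`((x₁ⁿ, …, x_{i-1}ⁿ) M :_M x_iⁿ) / (x₁ⁿ, …, x_{i-1}ⁿ) M`, `n ≥ 1`, is pro-zero. (The index `i` runs
from `0` here, so that `Fin.take i _ x` consists of the entries before the entry `x i`.) -/
def IsProRegular {r : ℕ} (x : Fin r → R) : Prop :=
  ∀ i : Fin r, IsProZero (colonTrans M (Fin.take i i.isLt.le x) (x i))

end ProRegular

section Torsion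

variable (M : Type v) [AddCommGroup M] [Module R M]

/-- `Γ_y(M)`: the submodule of the elements that are annihilated by a power of the ideal generated
by `y₁, …, yₖ`. -/
def gammaSub {k : ℕ} (y : Fin k → R) : Submodule R M where
  carrier := {z | ∃ n : ℕ, ∀ a ∈ Ideal.span (Set.range y) ^ n, a • z = 0}
  zero_mem' := ⟨0, fun a _ => smul_zero a⟩
  add_mem' := by
    rintro z z' ⟨n, hn⟩ ⟨m, hm⟩
    refine ⟨n + m, fun a ha => ?_⟩
    rw [smul_add, hn a (Ideal.pow_le_pow_right (Nat.le_add_right n m) ha),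
      hm a (Ideal.pow_le_pow_right (Nat.le_add_left m n) ha), add_zero]
  smul_mem' := by
    rintro c z ⟨n, hn⟩
    exact ⟨n, fun a ha => by rw [smul_comm, hn a ha, smul_zero]⟩

end Torsion

section Cech

variable (M : Type v) [AddCommGroup M] [Module R M]

/-- The localization `M_a = R_a ⊗ M` of a module at the powers of `a`. -/
abbrev LocAway (a : R) : Type max u v := LocalizedModule (Submonoid.powers a) M

theorem isUnit_of_dvd {a b : R} (h : a ∣ b) (s : Submonoid.powers a) :
    IsUnit (algebraMap R (Module.End R (LocAway M b)) s) := by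
  obtain ⟨_, n, rfl⟩ := s
  have hb : IsUnit (algebraMap R (Module.End R (LocAway M b)) b) :=
    IsLocalizedModule.map_units (LocalizedModule.mkLinearMap (Submonoid.powers b) M)
      ⟨b, Submonoid.mem_powers b⟩
  obtain ⟨c, rfl⟩ := h
  rw [map_mul, ((Commute.all a c).map (algebraMap R _)).isUnit_mul_iff] at hb
  simpa using hb.1.pow n

/-- The natural map `M_a → M_b` for `a ∣ b`. -/
def locMap {a b : R} (h : a ∣ b) : LocAway M a →ₗ[R] LocAway M b :=
  LocalizedModule.lift (Submonoid.powers a) (LocalizedModule.mkLinearMap (Submonoid.powers b) M)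
    (isUnit_of_dvd M h)

theorem locMap_mk {a b : R} (h : a ∣ b) (z : M) :
    locMap M h (LocalizedModule.mkLinearMap (Submonoid.powers a) M z) =
      LocalizedModule.mkLinearMap (Submonoid.powers b) M z := by
  simp [locMap, LocalizedModule.mkLinearMap_apply, LocalizedModule.lift_mk]

theorem locMap_locMap {a b c : R} (h : a ∣ b) (h' : b ∣ c) (z : LocAway M a) :
    locMap M h' (locMap M h z) = locMap M (h.trans h') z := by
  have : locMap M h' ∘ₗ locMap M h = locMap M (h.trans h') := by
    refine IsLocalizedModule.ext (Submonoid.powers a)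
      (LocalizedModule.mkLinearMap (Submonoid.powers a) M) (isUnit_of_dvd M (h.trans h')) ?_
    ext z
    simp only [LinearMap.comp_apply, locMap_mk]
  exact LinearMap.congr_fun this z

variable {r : ℕ} (x : Fin r → R)

/-- The product of the `x_i` with `i ∈ s`. -/
abbrev prodOn (s : Finset (Fin r)) : R := ∏ i ∈ s, x i

/-- The cochains of degree `k` of the Čech complex: the direct sum (over the finite set of the
`k`-element subsets `s` of the index set) of the localizations of `M` at `∏ i ∈ s, x i`. -/
abbrev CechCochain (k : ℕ) : Type max u v :=
  ∀ s : {s : Finset (Fin r) // s.card = k}, LocAway M (prodOn x s.1)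

/-- The face `t \ {i}` of a `(k + 1)`-element set `t`. -/
def face {k : ℕ} (t : {t : Finset (Fin r) // t.card = k + 1}) (i : t.1) :
    {s : Finset (Fin r) // s.card = k} :=
  ⟨t.1.erase i.1, by rw [Finset.card_erase_of_mem i.2, t.2, Nat.add_sub_cancel]⟩

/-- The position of `i` in the increasing enumeration of `t`, counted from `0`. -/
def pos (t : Finset (Fin r)) (i : Fin r) : ℕ := (t.filter (· < i)).card

theorem prodOn_face_dvd {k : ℕ} (t : {t : Finset (Fin r) // t.card = k + 1}) (i : t.1) :
    prodOn x (face t i).1 ∣ prodOn x t.1 :=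
  Finset.prod_dvd_prod_of_subset _ _ _ (Finset.erase_subset _ _)

/-- The differential of the Čech complex:
`(d c)_t = ∑ i ∈ t, (-1) ^ (position of i in t) • (image of c_{t \ {i}})`. -/
def cechD (k : ℕ) : CechCochain M x k →ₗ[R] CechCochain M x (k + 1) :=
  LinearMap.pi fun t => ∑ i : t.1,
    (-1 : R) ^ pos t.1 i.1 • (locMap M (prodOn_face_dvd x t i) ∘ₗ LinearMap.proj (face t i))

theorem cechD_apply (k : ℕ) (c : CechCochain M x k)
    (t : {t : Finset (Fin r) // t.card = k + 1}) :
    cechD M x k c t = ∑ i : t.1,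
      (-1 : R) ^ pos t.1 i.1 • locMap M (prodOn_face_dvd x t i) (c (face t i)) := by
  simp [cechD]

theorem pos_erase_of_lt (t : Finset (Fin r)) {i j : Fin r} (hi : i ∈ t) (h : i < j) :
    pos (t.erase i) j + 1 = pos t j := by
  unfold pos
  rw [Finset.filter_erase, Finset.card_erase_add_one (by simp [hi, h])]

theorem pos_erase_of_ge (t : Finset (Fin r)) {i j : Fin r} (h : j ≤ i) :
    pos (t.erase i) j = pos t j := by
  unfold pos
  rw [Finset.filter_erase, Finset.erase_eq_of_notMem (by simp [h])]

theorem sign_cancel (t : Finset (Fin r)) {i j : Fin r} (hi : i ∈ t) (hj : j ∈ t) (h : i ≠ j) :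
    (-1 : R) ^ (pos t i + pos (t.erase i) j) + (-1 : R) ^ (pos t j + pos (t.erase j) i) = 0 := by
  rcases lt_or_gt_of_ne h with h | h
  · rw [← pos_erase_of_lt t hi h, pos_erase_of_ge t h.le]; ring
  · rw [← pos_erase_of_lt t hj h, pos_erase_of_ge t h.le]; ring

theorem locMap_congr {k : ℕ} (c : CechCochain M x k) {b : R}
    {s s' : {s : Finset (Fin r) // s.card = k}} (h : s = s')
    (hs : prodOn x s.1 ∣ b) (hs' : prodOn x s'.1 ∣ b) :
    locMap M hs (c s) = locMap M hs' (c s') := by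
  subst h; rfl

theorem cechD_cechD (k : ℕ) : cechD M x (k + 1) ∘ₗ cechD M x k = 0 := by
  refine LinearMap.ext fun c => funext fun t => ?_
  simp only [LinearMap.comp_apply, cechD_apply, map_sum, map_smul, locMap_locMap, Finset.smul_sum,
    smul_smul, ← pow_add, LinearMap.zero_apply, Pi.zero_apply]
  rw [Finset.sum_sigma']
  have hm : ∀ p : (Σ i : t.1, (face t i).1), p.2.1 ∈ t.1 ∧ p.2.1 ≠ p.1.1 := fun p =>
    ⟨Finset.mem_of_mem_erase p.2.2, Finset.ne_of_mem_erase p.2.2⟩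
  refine Finset.sum_involution
    (fun p _ => ⟨⟨p.2.1, (hm p).1⟩, ⟨p.1.1, Finset.mem_erase.2 ⟨(hm p).2.symm, p.1.2⟩⟩⟩)
    ?_ ?_ ?_ ?_
  · intro p _
    have hf : face (face t ⟨p.2.1, (hm p).1⟩)
        ⟨p.1.1, Finset.mem_erase.2 ⟨(hm p).2.symm, p.1.2⟩⟩ = face (face t p.1) p.2 :=
      Subtype.ext (Finset.erase_right_comm)
    rw [locMap_congr M x c hf _
      ((prodOn_face_dvd x (face t p.1) p.2).trans (prodOn_face_dvd x t p.1)), ← add_smul]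
    have := sign_cancel (R := R) t.1 p.1.2 (hm p).1 (hm p).2.symm
    simp only [face]
    rw [this, zero_smul]
  · intro p _ _ h
    exact (hm p).2 (congrArg (fun q => q.1.1) h)
  · intro p _
    simp
  · intro p _
    rfl

/-- The Čech complex `Č_x(M) = Č_x ⊗ M`, that is
`0 → M → ⨁ i, M_{x_i} → ⨁ i < j, M_{x_i x_j} → ⋯ → M_{x_1 ⋯ x_r} → 0`. -/
def cechComplex : CochainComplex (ModuleCat.{max u v} R) ℕ :=
  CochainComplex.of (fun k => ModuleCat.of R (CechCochain M x k))
    (fun k => ModuleCat.ofHom (cechD M x k))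
    (fun k => by rw [← ModuleCat.ofHom_comp, cechD_cechD]; rfl)

/-- The Čech cohomology `Ȟ_x^k(M)`. -/
def cechCohomology (k : ℕ) : ModuleCat.{max u v} R := (cechComplex M x).homology k

end Cech

end CechProRegular

end

open CechProRegular
open scoped TensorProduct

noncomputable section

namespace CechProRegular

open CategoryTheory

/-! ### First Čech cohomology in terms of fractions. -/

section CechOne

variable {R : Type u} [CommRing R] (M : Type v) [AddCommGroup M] [Module R M]

/-! Write `y` for the entries before `a = x_i`. Pro-regularity says that for each `n` some `m` makes
`a ^ (m - n)` carry the kernel of `a ^ m : M → M/(y^m)M` into `(y^n)M`. A flat tensor product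
preserves this kernel, with the same `m`; conversely, take `F = R`.

For (i) ↔ (iii), `Γ_y(Hom(M, I))` is the union of the `Hom(M/(y^n)M, I)`, and `Ȟ_a^1(Γ) = 0` means
that `Γ → Γ_a` is onto. The kernel condition lets `a ^ (m - n) • f` factor through the image of `a ^
m` in `M/(y^m)M`, and injectivity of `I` extends it; conversely, embed `M/(y^n)M` in an injective
module and test on that map (`isProZero_iff_cechCohomology_gammaSub`).

For (iii) ↔ (iv), the elementwise counterpart of the exact sequence `0 → Ȟ_a^1(Γ_y X) → Ȟ_{y,a}^1(X)
→ Ȟ_y^1(X)_a`-type dévissage, for any module `X`, gives an induction on the length of the sequence.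
-/

theorem subsingleton_cechCohomology_one_iff_exact {r : ℕ} (x : Fin r → R) :
    Subsingleton (cechCohomology M x 1) ↔
      ∀ c : CechCochain M x 1, cechD M x 1 c = 0 → ∃ b, cechD M x 0 b = c := by
  rw [← ModuleCat.isZero_iff_subsingleton, cechCohomology,
    ← HomologicalComplex.exactAt_iff_isZero_homology,
    HomologicalComplex.exactAt_iff' _ 0 1 2 (by simp) (by simp),
    ShortComplex.moduleCat_exact_iff]
  have h0 : (cechComplex M x).d 0 1 = ModuleCat.ofHom (cechD M x 0) :=
    CochainComplex.of_d (fun k => ModuleCat.of R (CechCochain M x k))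
      (fun k => ModuleCat.ofHom (cechD M x k)) 0
  have h1 : (cechComplex M x).d 1 2 = ModuleCat.ofHom (cechD M x 1) :=
    CochainComplex.of_d (fun k => ModuleCat.of R (CechCochain M x k))
      (fun k => ModuleCat.ofHom (cechD M x k)) 1
  simp only [HomologicalComplex.shortComplexFunctor'_obj_f,
    HomologicalComplex.shortComplexFunctor'_obj_g, h0, h1]
  rfl

variable {M}

/-- The canonical map `M → M_b`. -/
abbrev toLoc (b : R) : M →ₗ[R] LocAway M b :=
  LocalizedModule.mkLinearMap (Submonoid.powers b) M

theorem toLoc_eq_iff {b b' : R} (hb : b = b') {z z' : M} :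
    toLoc b z = toLoc b z' ↔ ∃ n : ℕ, b' ^ n • z = b' ^ n • z' := by
  subst hb
  rw [IsLocalizedModule.eq_iff_exists (Submonoid.powers b) (toLoc b)]
  constructor
  · rintro ⟨⟨_, n, rfl⟩, h⟩
    exact ⟨n, h⟩
  · rintro ⟨n, h⟩
    exact ⟨⟨_, n, rfl⟩, h⟩

theorem exists_pow_smul_eq_toLoc {b b' : R} (hb : b = b') (c : LocAway M b) :
    ∃ (n : ℕ) (z : M), b' ^ n • c = toLoc b z := by
  subst hb
  obtain ⟨⟨z, ⟨_, n, rfl⟩⟩, h⟩ := IsLocalizedModule.surj (Submonoid.powers b) (toLoc b) c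
  exact ⟨n, z, h⟩

theorem exists_pow_smul_eq {b b' : R} (hb : b = b') (n : ℕ) (z : M) :
    ∃ c : LocAway M b, b' ^ n • c = toLoc b z := by
  subst hb
  refine ⟨IsLocalizedModule.mk' (toLoc b) z (⟨b ^ n, n, rfl⟩ : Submonoid.powers b), ?_⟩
  exact IsLocalizedModule.mk'_cancel' (toLoc b) z (⟨b ^ n, n, rfl⟩ : Submonoid.powers b)

theorem pow_smul_injective {a b : R} (h : a ∣ b) (n : ℕ) :
    Function.Injective fun c : LocAway M b => a ^ n • c := by
  have := isUnit_of_dvd M h ⟨a ^ n, n, rfl⟩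
  exact ((Module.End.isUnit_iff _).1 this).1

variable {r : ℕ} (x : Fin r → R)

/-- The one-element set `{j}`. -/
def singleFace (j : Fin r) : {s : Finset (Fin r) // s.card = 1} := ⟨{j}, Finset.card_singleton j⟩

/-- The two-element set `{i, j}`. -/
def pairFace {i j : Fin r} (h : i < j) : {s : Finset (Fin r) // s.card = 1 + 1} :=
  ⟨{i, j}, Finset.card_pair h.ne⟩

/-- The empty set. -/
def emptyFace : {s : Finset (Fin r) // s.card = 0} := ⟨∅, Finset.card_empty⟩

theorem prodOn_singleFace (j : Fin r) : prodOn x (singleFace j).1 = x j :=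
  Finset.prod_singleton _ _

theorem prodOn_pairFace {i j : Fin r} (h : i < j) : prodOn x (pairFace h).1 = x i * x j :=
  Finset.prod_pair h.ne

theorem prodOn_singleFace_dvd_left {i j : Fin r} (h : i < j) :
    prodOn x (singleFace i).1 ∣ prodOn x (pairFace h).1 := by
  rw [prodOn_singleFace, prodOn_pairFace]; exact dvd_mul_right _ _

theorem prodOn_singleFace_dvd_right {i j : Fin r} (h : i < j) :
    prodOn x (singleFace j).1 ∣ prodOn x (pairFace h).1 := by
  rw [prodOn_singleFace, prodOn_pairFace]; exact dvd_mul_left _ _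

theorem prodOn_emptyFace : prodOn x (emptyFace (r := r)).1 = 1 := Finset.prod_empty

theorem prodOn_emptyFace_dvd (b : R) : prodOn x (emptyFace (r := r)).1 ∣ b := by
  rw [prodOn_emptyFace]; exact one_dvd b

theorem exists_eq_singleFace (s : {s : Finset (Fin r) // s.card = 1}) :
    ∃ j, s = singleFace j := by
  obtain ⟨j, hj⟩ := Finset.card_eq_one.1 s.2
  exact ⟨j, Subtype.ext hj⟩

theorem exists_eq_pairFace (t : {t : Finset (Fin r) // t.card = 1 + 1}) :
    ∃ (i j : Fin r) (h : i < j), t = pairFace h := by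
  obtain ⟨i, j, hij, ht⟩ := Finset.card_eq_two.1 t.2
  rcases lt_or_gt_of_ne hij with h | h
  · exact ⟨i, j, h, Subtype.ext ht⟩
  · exact ⟨j, i, h, Subtype.ext (ht.trans (Finset.pair_comm _ _))⟩

theorem cechD_zero_singleFace (b : CechCochain M x 0) (j : Fin r) :
    cechD M x 0 b (singleFace j) =
      locMap M (prodOn_emptyFace_dvd x _) (b emptyFace) := by
  rw [cechD_apply]
  have hu : (Finset.univ : Finset (singleFace j).1) =
      {⟨j, Finset.mem_singleton_self j⟩} := by
    ext ⟨i, hi⟩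
    have hi' : i = j := by simpa [singleFace] using hi
    simp [hi']
  rw [hu, Finset.sum_singleton]
  have hp : pos (singleFace j).1 j = 0 := by simp [pos, singleFace, Finset.filter_singleton]
  have hf : face (k := 0) (singleFace j) ⟨j, Finset.mem_singleton_self j⟩ = emptyFace :=
    Subtype.ext (by simp [face, singleFace, emptyFace])
  rw [hp, pow_zero, one_smul]
  exact locMap_congr M x b hf _ _

theorem cechD_one_pairFace (c : CechCochain M x 1) {i j : Fin r} (h : i < j) :
    cechD M x 1 c (pairFace h) =
      locMap M (prodOn_singleFace_dvd_right x h) (c (singleFace j)) -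
        locMap M (prodOn_singleFace_dvd_left x h) (c (singleFace i)) := by
  rw [cechD_apply]
  have hi : i ∈ (pairFace h).1 := Finset.mem_insert_self _ _
  have hj : j ∈ (pairFace h).1 := Finset.mem_insert_of_mem (Finset.mem_singleton_self _)
  have hu : (Finset.univ : Finset (pairFace h).1) = {⟨i, hi⟩, ⟨j, hj⟩} := by
    ext ⟨l, hl⟩
    have hl' : l = i ∨ l = j := by simpa [pairFace] using hl
    simpa using hl'
  rw [hu, Finset.sum_pair (by simpa using h.ne)]
  have hpi : pos (pairFace h).1 i = 0 := by
    simp [pos, pairFace, Finset.filter_insert, Finset.filter_singleton, h.le]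
  have hpj : pos (pairFace h).1 j = 1 := by
    simp [pos, pairFace, Finset.filter_insert, Finset.filter_singleton, h]
  have hfi : face (pairFace h) ⟨i, hi⟩ = singleFace j :=
    Subtype.ext (by
      simp only [face, pairFace, singleFace]
      exact Finset.erase_insert (by simpa using h.ne))
  have hfj : face (pairFace h) ⟨j, hj⟩ = singleFace i :=
    Subtype.ext (by
      simp only [face, pairFace, singleFace, Finset.pair_comm i j]
      exact Finset.erase_insert (by simpa using h.ne'))
  rw [hpi, hpj, pow_zero, one_smul, pow_one, neg_smul, one_smul, ← sub_eq_add_neg]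
  exact congrArg₂ _ (locMap_congr M x c hfi _ _) (locMap_congr M x c hfj _ _)

/-- `Ȟ_x^1(M) = 0` in terms of elements: a compatible family of fractions `a_j / x_jⁿ` is given by
an element of `M`. -/
theorem subsingleton_cechCohomology_one_iff :
    Subsingleton (cechCohomology M x 1) ↔
      ∀ (n : ℕ) (a : Fin r → M),
        (∀ i j, i < j →
          ∃ N : ℕ, (x i * x j) ^ N • x j ^ n • a i = (x i * x j) ^ N • x i ^ n • a j) →
        ∃ z : M, ∀ j, ∃ N : ℕ, x j ^ N • a j = x j ^ N • x j ^ n • z := by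
  rw [subsingleton_cechCohomology_one_iff_exact]
  have hcocycle : ∀ (c : CechCochain M x 1) (n : ℕ) (a : Fin r → M),
      (∀ j, x j ^ n • c (singleFace j) = toLoc _ (a j)) →
      ∀ {i j} (h : i < j), cechD M x 1 c (pairFace h) = 0 ↔
        ∃ N : ℕ, (x i * x j) ^ N • x j ^ n • a i = (x i * x j) ^ N • x i ^ n • a j := by
    intro c n a hc i j h
    -- Clear denominators: `(x_i x_j) ^ n` acts injectively on the localization.
    have hinj := pow_smul_injective (M := M) (dvd_refl (prodOn x (pairFace h).1)) n
    rw [cechD_one_pairFace, sub_eq_zero, ← hinj.eq_iff, eq_comm]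
    simp only [← map_smul, prodOn_pairFace, mul_pow]
    rw [mul_comm (x i ^ n), mul_smul, hc i, mul_comm (x j ^ n), mul_smul, hc j, map_smul, map_smul,
      locMap_mk, locMap_mk, ← map_smul, ← map_smul, toLoc_eq_iff (prodOn_pairFace x h)]
    simp only [mul_pow]
  have hcobound : ∀ (c : CechCochain M x 1) (n : ℕ) (a : Fin r → M),
      (∀ j, x j ^ n • c (singleFace j) = toLoc _ (a j)) →
      ((∃ b, cechD M x 0 b = c) ↔
        ∃ z : M, ∀ j, ∃ N : ℕ, x j ^ N • a j = x j ^ N • x j ^ n • z) := by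
    intro c n a hc
    have hz : ∀ (z : M) j, toLoc _ z = c (singleFace j) ↔
        ∃ N : ℕ, x j ^ N • a j = x j ^ N • x j ^ n • z := by
      intro z j
      have hinj := pow_smul_injective (M := M) (prodOn_singleFace x j).symm.dvd n
      rw [← hinj.eq_iff, eq_comm, hc, ← map_smul, toLoc_eq_iff (prodOn_singleFace x j)]
    simp only [← hz]
    constructor
    · rintro ⟨b, rfl⟩
      obtain ⟨n, z, hbz⟩ := exists_pow_smul_eq_toLoc (prodOn_emptyFace x) (b emptyFace)
      refine ⟨z, fun j => ?_⟩
      rw [one_pow, one_smul] at hbz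
      rw [cechD_zero_singleFace, hbz, locMap_mk]
    · rintro ⟨z, hz⟩
      refine ⟨fun s => toLoc _ z, funext fun s => ?_⟩
      obtain ⟨j, rfl⟩ := exists_eq_singleFace s
      rw [cechD_zero_singleFace, locMap_mk, hz]
  constructor
  · intro H n a ha
    -- The sum over `s` names `a j` for the only element `j` of `s` without choosing it.
    choose c hc using fun s : {s : Finset (Fin r) // s.card = 1} =>
      exists_pow_smul_eq (rfl : prodOn x s.1 = prodOn x s.1) n (∑ j ∈ s.1, a j)
    have hc' : ∀ j, x j ^ n • c (singleFace j) = toLoc _ (a j) := fun j => by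
      simpa only [prodOn_singleFace, singleFace, Finset.sum_singleton, Finset.prod_singleton]
        using hc (singleFace j)
    refine (hcobound c n a hc').1 (H c (funext fun t => ?_))
    obtain ⟨i, j, h, rfl⟩ := exists_eq_pairFace t
    exact (hcocycle c n a hc' h).2 (ha i j h)
  · intro H c hc
    choose n₀ a₀ ha₀ using fun j => exists_pow_smul_eq_toLoc (prodOn_singleFace x j) (c (singleFace j))
    -- The sum of the exponents serves as a common denominator exponent.
    have hn : ∀ j, n₀ j ≤ ∑ l, n₀ l := fun j =>
      Finset.single_le_sum (fun _ _ => Nat.zero_le _) (Finset.mem_univ j)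
    have hc' : ∀ j, x j ^ (∑ l, n₀ l) • c (singleFace j) =
        toLoc _ (x j ^ (∑ l, n₀ l - n₀ j) • a₀ j) := fun j => by
      rw [map_smul, ← ha₀ j, smul_smul, ← pow_add, Nat.sub_add_cancel (hn j)]
    exact (hcobound c _ _ hc').2 (H _ _ fun i j h =>
      (hcocycle c _ _ hc' h).1 (congrFun hc (pairFace h)))

end CechOne

/-! ### Pro-zero colon systems and duality with injective modules. -/

section ProZero

variable {R : Type u} [CommRing R] {M : Type v} [AddCommGroup M] [Module R M]
variable {k : ℕ} (y : Fin k → R) (a : R)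

theorem colonTrans_mk {n m : ℕ} (h : n ≤ m) (z : colonSub M y a m) :
    colonTrans M y a n m h (Submodule.Quotient.mk z) =
      Submodule.Quotient.mk ⟨a ^ (m - n) • z.1, smul_mem_colonSub M y a h z.1 z.2⟩ := rfl

theorem isProZero_colonTrans_iff :
    IsProZero (colonTrans M y a) ↔
      ∀ n : ℕ, 1 ≤ n → ∃ m : ℕ, n ≤ m ∧
        ∀ z : M, a ^ m • z ∈ powSub M y m → a ^ (m - n) • z ∈ powSub M y n := by
  refine forall₂_congr fun n _ => ?_
  have key : ∀ m (h : n ≤ m), colonTrans M y a n m h = 0 ↔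
      ∀ z : M, a ^ m • z ∈ powSub M y m → a ^ (m - n) • z ∈ powSub M y n := by
    intro m h
    constructor
    · intro H z hz
      have := LinearMap.congr_fun H (Submodule.Quotient.mk ⟨z, hz⟩)
      rw [colonTrans_mk, LinearMap.zero_apply, Submodule.Quotient.mk_eq_zero] at this
      exact this
    · intro H
      refine Submodule.linearMap_qext _ (LinearMap.ext fun z => ?_)
      rw [LinearMap.comp_apply, Submodule.mkQ_apply, colonTrans_mk,
        LinearMap.zero_comp, LinearMap.zero_apply, Submodule.Quotient.mk_eq_zero]
      exact H z.1 z.2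
  exact ⟨fun ⟨m, h, H⟩ => ⟨m, h, (key m h).1 H⟩, fun ⟨m, h, H⟩ => ⟨m, h, (key m h).2 H⟩⟩

theorem powSub_le_iff {n : ℕ} {N : Submodule R M} :
    powSub M y n ≤ N ↔ ∀ (j : Fin k) (z : M), y j ^ n • z ∈ N := by
  constructor
  · exact fun h j z =>
      h (Submodule.smul_mem_smul (Ideal.subset_span ⟨j, rfl⟩) Submodule.mem_top)
  · intro h
    refine Submodule.smul_le.2 fun c hc z _ => ?_
    have hle : Ideal.span (Set.range fun j => y j ^ n) ≤
        N.comap (LinearMap.toSpanSingleton R M z) := by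
      rw [Ideal.span_le]
      rintro _ ⟨j, rfl⟩
      exact h j z
    exact hle hc

theorem pow_smul_mem_powSub (n : ℕ) (j : Fin k) (z : M) : y j ^ n • z ∈ powSub M y n :=
  (powSub_le_iff y).1 le_rfl j z

theorem map_powSub_le {N : Type*} [AddCommGroup N] [Module R N] (f : M →ₗ[R] N) (n : ℕ) :
    powSub M y n ≤ (powSub N y n).comap f := by
  refine (powSub_le_iff y).2 fun j z => ?_
  rw [Submodule.mem_comap, map_smul]
  exact pow_smul_mem_powSub y n j _

variable {y} in
-- A finitely generated ideal inside the radical of the annihilator of `z` has a power inside that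
-- annihilator.
theorem mem_gammaSub_iff {z : M} : z ∈ gammaSub M y ↔ ∀ j, ∃ n : ℕ, y j ^ n • z = 0 := by
  constructor
  · rintro ⟨n, hn⟩ j
    exact ⟨n, hn _ (Ideal.pow_mem_pow (Ideal.subset_span (Set.mem_range_self j)) n)⟩
  · intro h
    let A : Ideal R := LinearMap.ker (LinearMap.toSpanSingleton R M z)
    have hA : Ideal.span (Set.range y) ≤ A.radical := by
      rw [Ideal.span_le]
      intro _ hj
      obtain ⟨j, rfl⟩ := hj
      obtain ⟨n, hn⟩ := h j
      exact ⟨n, hn⟩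
    obtain ⟨n, hn⟩ := Ideal.exists_pow_le_of_le_radical_of_fg hA
      (Submodule.fg_span (Set.finite_range y))
    exact ⟨n, fun c hc => hn hc⟩

variable {y} in
-- Torsion homomorphisms are those factoring through some `M/(y^n)M`, since finitely many exponents
-- have a common bound. The level is at least 1 to match the inverse system.
theorem mem_gammaSub_hom_iff {I : Type*} [AddCommGroup I] [Module R I] {f : M →ₗ[R] I} :
    f ∈ gammaSub (M →ₗ[R] I) y ↔ ∃ n : ℕ, 1 ≤ n ∧ powSub M y n ≤ LinearMap.ker f := by
  rw [mem_gammaSub_iff]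
  constructor
  · intro h
    choose n hn using h
    refine ⟨∑ j, n j + 1, Nat.le_add_left _ _, (powSub_le_iff y).2 fun j z => ?_⟩
    have hj : n j ≤ ∑ j, n j + 1 :=
      (Finset.single_le_sum (fun _ _ => Nat.zero_le _) (Finset.mem_univ j)).trans (Nat.le_succ _)
    rw [LinearMap.mem_ker, ← Nat.sub_add_cancel hj, pow_add, mul_smul, map_smul, map_smul,
      ← LinearMap.smul_apply (y j ^ n j), hn, LinearMap.zero_apply, smul_zero]
  · rintro ⟨n, -, h⟩ j
    refine ⟨n, LinearMap.ext fun z => ?_⟩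
    rw [LinearMap.smul_apply, ← map_smul]
    exact (powSub_le_iff y).1 h j z

theorem exists_injective_embedding (N : Type v) [AddCommGroup N] [Module R N] :
    ∃ (I : Type (max u v w')) (_ : AddCommGroup I) (_ : Module R I) (_ : Module.Injective R I)
      (f : N →ₗ[R] I), Function.Injective f := by
  obtain ⟨J, hJ, f, hf⟩ :=
    EnoughInjectives.presentation (ModuleCat.of R (ULift.{max u w'} N) : ModuleCat.{max u v w'} R)
  refine ⟨J, inferInstance, inferInstance, Module.injective_module_of_injective_object R J,
    f.hom ∘ₗ ULift.moduleEquiv.symm.toLinearMap, ?_⟩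
  exact ((ModuleCat.mono_iff_injective f).1 hf).comp ULift.moduleEquiv.symm.injective

/-- With one element the cocycle condition is vacuous, so vanishing means that every fraction `f / a
^ n` comes from `Γ_y(X)`. -/
theorem subsingleton_cechCohomology_gammaSub_iff (X : Type v) [AddCommGroup X] [Module R X] :
    Subsingleton (cechCohomology (gammaSub X y) ![a] 1) ↔
      ∀ (n : ℕ), ∀ f ∈ gammaSub X y, ∃ h ∈ gammaSub X y, ∃ N : ℕ,
        a ^ N • f = a ^ N • a ^ n • h := by
  rw [subsingleton_cechCohomology_one_iff]
  constructor
  · intro H n f hf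
    obtain ⟨h, hh⟩ := H n (fun _ => ⟨f, hf⟩) fun i j hij => by omega
    obtain ⟨N, hN⟩ := hh 0
    exact ⟨h, h.2, N, congrArg Subtype.val hN⟩
  · intro H n f _
    obtain ⟨h, hh, N, hN⟩ := H n (f 0) (f 0).2
    refine ⟨⟨h, hh⟩, fun j => ⟨N, Subtype.ext ?_⟩⟩
    rw [Subsingleton.elim j 0]
    exact hN

/-- The colon system of `y` and `a` is pro-zero if and only if `Ȟ_a^1(Γ_y(Hom(M, I)))` vanishes for
every injective module `I`. -/
theorem isProZero_iff_cechCohomology_gammaSub :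
    IsProZero (colonTrans M y a) ↔
      ∀ (I : Type (max u v w')) [AddCommGroup I] [Module R I] [Module.Injective R I],
        Subsingleton (cechCohomology (gammaSub (M →ₗ[R] I) y) ![a] 1) := by
  simp only [isProZero_colonTrans_iff, subsingleton_cechCohomology_gammaSub_iff]
  constructor
  · intro H I _ _ _ d f hf
    obtain ⟨n, hn, hfn⟩ := mem_gammaSub_hom_iff.1 hf
    -- Level `n + d` leaves a spare factor `a ^ d` to cancel the denominator of `f / a ^ d`.
    have hn' : 1 ≤ n + d := by omega
    obtain ⟨m, hm, hH⟩ := H (n + d) hn'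
    let q : M →ₗ[R] M ⧸ powSub M y m := (powSub M y m).mkQ ∘ₗ LinearMap.lsmul R M (a ^ m)
    have hq : LinearMap.ker q ≤ LinearMap.ker (a ^ (m - (n + d)) • f) := by
      intro z hz
      have hz' : a ^ m • z ∈ powSub M y m := (Submodule.Quotient.mk_eq_zero _).1 hz
      rw [LinearMap.mem_ker, LinearMap.smul_apply, ← map_smul]
      exact hfn (powSub_anti M y (Nat.le_add_right n d) (hH z hz'))
    -- Extend along the injection `M / ker q → M/(y^m)M`.
    obtain ⟨h, hh⟩ := Module.Injective.extension_property R I _ _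
      ((LinearMap.ker q).liftQ q le_rfl)
      (LinearMap.ker_eq_bot.1 (Submodule.ker_liftQ_eq_bot' _ _ rfl))
      ((LinearMap.ker q).liftQ _ hq)
    have hfac : ∀ z, h (q z) = a ^ (m - (n + d)) • f z := fun z =>
      LinearMap.congr_fun hh (Submodule.Quotient.mk z)
    let g : M →ₗ[R] I := h ∘ₗ (powSub M y m).mkQ
    have hg : g ∈ gammaSub (M →ₗ[R] I) y := by
      refine mem_gammaSub_hom_iff.2 ⟨m, hn'.trans hm, fun z hz => ?_⟩
      rw [LinearMap.mem_ker, LinearMap.comp_apply, Submodule.mkQ_apply,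
        (Submodule.Quotient.mk_eq_zero _).2 hz, map_zero]
    refine ⟨a ^ n • g, Submodule.smul_mem _ _ hg, m - (n + d), LinearMap.ext fun z => ?_⟩
    rw [LinearMap.smul_apply, ← hfac, smul_smul, smul_smul, ← pow_add, ← pow_add,
      show m - (n + d) + d + n = m by omega, LinearMap.smul_apply, ← map_smul]
    rfl
  · intro H n hn
    obtain ⟨I, _, _, _, e, he⟩ := exists_injective_embedding.{u, v, w'} (R := R) (M ⧸ powSub M y n)
    let f : M →ₗ[R] I := e ∘ₗ (powSub M y n).mkQ
    have hf : LinearMap.ker f = powSub M y n := by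
      rw [LinearMap.ker_comp_of_ker_eq_bot _ (LinearMap.ker_eq_bot.2 he), Submodule.ker_mkQ]
    obtain ⟨h, hh, N, hN⟩ := H I n f (mem_gammaSub_hom_iff.2 ⟨n, hn, hf.ge⟩)
    obtain ⟨l, -, hl⟩ := mem_gammaSub_hom_iff.1 hh
    -- `n` is the denominator exponent, `N` witnesses equality of fractions, and `h` kills `(y^l)M`.
    refine ⟨n + N + l, by omega, fun z hz => ?_⟩
    have h0 : h (a ^ (n + N + l) • z) = 0 := hl (powSub_anti M y (Nat.le_add_left l _) hz)
    have hN' := LinearMap.congr_fun hN z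
    simp only [LinearMap.smul_apply, ← map_smul] at hN'
    rw [← hf, LinearMap.mem_ker, show n + N + l - n = l + N by omega, pow_add, mul_smul, map_smul,
      hN', ← map_smul, smul_smul, smul_smul, ← pow_add, ← pow_add,
      show l + N + n = n + N + l by omega, h0]

end ProZero

/-! ### Adjoining one element to the sequence. -/

section Sequence

variable {R : Type u} [CommRing R] {X : Type v} [AddCommGroup X] [Module R X]
variable {r : ℕ} (x : Fin r → R)

/-- The submodule `Ȟ_{x_i}^1(Γ_{x_1, …, x_{i-1}}(X))` of `Ȟ_{x_1, …, x_i}^1(X)` vanishes if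
the latter does. -/
theorem subsingleton_gammaSub_of_subsingleton {k : ℕ} (y : Fin k → R) (a : R)
    (H : Subsingleton (cechCohomology X (Fin.snoc (α := fun _ => R) y a) 1)) :
    Subsingleton (cechCohomology (gammaSub X y) ![a] 1) := by
  rw [subsingleton_cechCohomology_gammaSub_iff]
  rw [subsingleton_cechCohomology_one_iff] at H
  intro n f hf
  -- The family with 0 at each `y_j` and `f / a ^ n` at `a` is a cocycle because `f` is `y`-torsion.
  -- A `z` inducing it vanishes in every `X_{y_j}`, hence is `y`-torsion itself.
  obtain ⟨z, hz⟩ := H n (Fin.snoc (α := fun _ => X) (fun _ => 0) f) fun i j hij => by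
    obtain ⟨i, rfl⟩ := Fin.exists_castSucc_eq.2 (hij.trans_le (Fin.le_last j)).ne
    induction j using Fin.lastCases with
    | cast j => exact ⟨0, by simp⟩
    | last =>
      obtain ⟨N, hN⟩ := mem_gammaSub_iff.1 hf i
      refine ⟨N, ?_⟩
      simp only [Fin.snoc_castSucc, Fin.snoc_last, smul_zero]
      rw [mul_pow, smul_smul, mul_comm, mul_comm (y i ^ N), ← mul_assoc, mul_smul, hN, smul_zero]
  refine ⟨z, mem_gammaSub_iff.2 fun j => ?_, ?_⟩
  · obtain ⟨N, hN⟩ := hz j.castSucc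
    simp only [Fin.snoc_castSucc, smul_zero] at hN
    exact ⟨N + n, by rw [pow_add, mul_smul, ← hN]⟩
  · simpa using hz (Fin.last k)

/-- `Ȟ_{x_1, …, x_i}^1(X)` vanishes if `Ȟ_{x_1, …, x_{i-1}}^1(X)` and
`Ȟ_{x_i}^1(Γ_{x_1, …, x_{i-1}}(X))` do. -/
theorem subsingleton_snoc_of_subsingleton {k : ℕ} (y : Fin k → R) (a : R)
    (H : Subsingleton (cechCohomology X y 1))
    (H' : Subsingleton (cechCohomology (gammaSub X y) ![a] 1)) :
    Subsingleton (cechCohomology X (Fin.snoc (α := fun _ => R) y a) 1) := by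
  rw [subsingleton_cechCohomology_gammaSub_iff] at H'
  rw [subsingleton_cechCohomology_one_iff] at H ⊢
  intro n c hc
  obtain ⟨z, hz⟩ := H n (fun j => c j.castSucc) fun i j hij => by
    simpa using hc i.castSucc j.castSucc (by simpa using hij)
  choose N hN using hz
  choose L hL using fun j : Fin k => hc j.castSucc (Fin.last k) (Fin.castSucc_lt_last j)
  simp only [Fin.snoc_castSucc, Fin.snoc_last] at hL
  have hLle : ∀ j, L j ≤ ∑ l, L l := fun j =>
    Finset.single_le_sum (fun _ _ => Nat.zero_le _) (Finset.mem_univ j)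
  -- `b / a ^ n` is the error of `z` at the last coordinate. Compatibility with the other
  -- coordinates makes it `y`-torsion, up to a power of `a`.
  let b : X := c (Fin.last k) - a ^ n • z
  have hb : a ^ (∑ l, L l) • b ∈ gammaSub X y := by
    refine mem_gammaSub_iff.2 fun j => ⟨N j + L j + n, ?_⟩
    have h1 : (y j * a) ^ L j • y j ^ n • c (Fin.last k) =
      (y j * a) ^ L j • a ^ n • c j.castSucc := (hL j).symm
    have h2 := hN j
    have e1 : y j ^ (N j + L j + n) • a ^ (∑ l, L l) • c (Fin.last k) =
        (a ^ (∑ l, L l - L j) * y j ^ N j) • (y j * a) ^ L j • y j ^ n • c (Fin.last k) := by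
      conv_lhs => rw [← Nat.sub_add_cancel (hLle j)]
      simp only [smul_smul]
      congr 1
      ring
    have e2 : (a ^ (∑ l, L l - L j) * y j ^ N j) • (y j * a) ^ L j • a ^ n • c j.castSucc =
        (a ^ (∑ l, L l - L j) * (y j * a) ^ L j * a ^ n) • y j ^ N j • c j.castSucc := by
      simp only [smul_smul]
      congr 1
      ring
    have e3 : y j ^ (N j + L j + n) • a ^ (∑ l, L l) • a ^ n • z =
        (a ^ (∑ l, L l - L j) * (y j * a) ^ L j * a ^ n) • y j ^ N j • y j ^ n • z := by
      conv_lhs => rw [← Nat.sub_add_cancel (hLle j)]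
      simp only [smul_smul]
      congr 1
      ring
    rw [smul_sub, smul_sub, e1, h1, e2, h2, e3, sub_self]
  -- The denominator absorbs the extra factor, so `h` represents `b / a ^ n`; being `y`-torsion, it
  -- does not disturb the coordinates at the `y_j`.
  obtain ⟨h, hh, K, hK⟩ := H' (∑ l, L l + n) _ hb
  refine ⟨z + h, fun j => ?_⟩
  induction j using Fin.lastCases with
  | cast j =>
    obtain ⟨P, hP⟩ := mem_gammaSub_iff.1 hh j
    refine ⟨P + N j, ?_⟩
    simp only [Fin.snoc_castSucc]
    rw [smul_add, smul_add, pow_add, mul_smul, hN j, smul_smul _ _ h,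
      show y j ^ P * y j ^ N j * y j ^ n = (y j ^ N j * y j ^ n) * y j ^ P by ring,
      mul_smul _ _ h, hP, smul_zero, add_zero, mul_smul]
  | last =>
    refine ⟨K + ∑ l, L l, ?_⟩
    simp only [Fin.snoc_last]
    have hK' : a ^ (K + ∑ l, L l) • b = a ^ (K + ∑ l, L l) • a ^ n • h := by
      rw [pow_add, mul_smul, hK]
      simp only [smul_smul]
      congr 1
      ring
    rw [smul_add, smul_add, ← hK', ← smul_add]
    congr 1
    simp [b]

theorem take_succ_eq_snoc {S : Type*} (x : Fin r → S) (i : Fin r) :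
    Fin.take (i + 1) (Nat.succ_le_of_lt i.isLt) x =
      Fin.snoc (α := fun _ => S) (Fin.take i i.isLt.le x) (x i) :=
  Fin.take_succ_eq_snoc i i.isLt x

theorem subsingleton_cechCohomology_take_iff :
    (∀ i : Fin r, Subsingleton
        (cechCohomology (gammaSub X (Fin.take i i.isLt.le x)) ![x i] 1)) ↔
      ∀ i : Fin r, Subsingleton
        (cechCohomology X (Fin.take (i + 1) (Nat.succ_le_of_lt i.isLt) x) 1) := by
  constructor
  · intro H
    have key : ∀ k (hk : k ≤ r), Subsingleton (cechCohomology X (Fin.take k hk x) 1) := by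
      intro k
      induction k with
      | zero =>
        intro hk
        rw [subsingleton_cechCohomology_one_iff]
        exact fun _ _ _ => ⟨0, fun j => j.elim0⟩
      | succ k ih =>
        intro hk
        rw [take_succ_eq_snoc x ⟨k, hk⟩]
        exact subsingleton_snoc_of_subsingleton _ _ (ih _) (H ⟨k, hk⟩)
    exact fun i => key _ _
  · intro H i
    have := H i
    rw [take_succ_eq_snoc] at this
    exact subsingleton_gammaSub_of_subsingleton _ _ this

end Sequence

/-! ### Flat base change of the pro-zero condition. -/

section Flat

open scoped TensorProduct

variable {R : Type u} [CommRing R] {M : Type v} [AddCommGroup M] [Module R M]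
variable {k : ℕ} (y : Fin k → R) (a : R)

theorem IsProZero.colonTrans_tensor {F : Type w} [AddCommGroup F] [Module R F] [Module.Flat R F]
    (H : IsProZero (colonTrans M y a)) : IsProZero (colonTrans (M ⊗[R] F) y a) := by
  rw [isProZero_colonTrans_iff] at H ⊢
  intro n hn
  obtain ⟨m, hm, hH⟩ := H n hn
  refine ⟨m, hm, fun z hz => ?_⟩
  let q : M →ₗ[R] M ⧸ powSub M y m := (powSub M y m).mkQ ∘ₗ LinearMap.lsmul R M (a ^ m)
  -- By flatness the kernel of `q ⊗ F` is the image of `ker q ⊗ F`, so the claim reduces to pure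
  -- tensors `u ⊗ f` with `u` in `ker q`.
  have hex := Module.Flat.rTensor_exact (M := F) (LinearMap.exact_subtype_ker_map q)
  have hvanish : powSub (M ⊗[R] F) y m ≤ LinearMap.ker ((powSub M y m).mkQ.rTensor F) := by
    refine (powSub_le_iff y).2 fun j t => ?_
    rw [LinearMap.mem_ker]
    induction t with
    | zero => simp
    | add s t hs ht => rw [smul_add, map_add, hs, ht, add_zero]
    | tmul u f =>
      rw [TensorProduct.smul_tmul', LinearMap.rTensor_tmul, Submodule.mkQ_apply,
        (Submodule.Quotient.mk_eq_zero _).2 (pow_smul_mem_powSub y m j u), TensorProduct.zero_tmul]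
  have hqz : q.rTensor F z = 0 := by
    have : q.rTensor F z = (powSub M y m).mkQ.rTensor F (a ^ m • z) := by
      rw [map_smul, ← LinearMap.smul_apply, ← LinearMap.rTensor_smul]
      rfl
    rw [this]
    exact hvanish hz
  obtain ⟨t, rfl⟩ := (hex z).1 hqz
  clear hqz hz
  induction t with
  | zero => simp
  | add s t hs ht =>
    rw [map_add, smul_add]
    exact add_mem hs ht
  | tmul u f =>
    have hu : a ^ m • (u : M) ∈ powSub M y m := (Submodule.Quotient.mk_eq_zero _).1 u.2
    exact map_powSub_le y ((TensorProduct.mk R M F).flip f) n (hH u hu)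

theorem IsProZero.colonTrans_of_equiv {N : Type w} [AddCommGroup N] [Module R N] (e : M ≃ₗ[R] N)
    (H : IsProZero (colonTrans M y a)) : IsProZero (colonTrans N y a) := by
  rw [isProZero_colonTrans_iff] at H ⊢
  intro n hn
  obtain ⟨m, hm, hH⟩ := H n hn
  refine ⟨m, hm, fun z hz => ?_⟩
  have h1 := hH (e.symm z) (by
    rw [← map_smul]
    exact map_powSub_le y e.symm.toLinearMap m hz)
  have h2 := map_powSub_le y e.toLinearMap n h1
  simpa using h2

end Flat

end CechProRegular

end

theorem theorem4p4 {R : Type u} [CommRing R] {r : ℕ} (x : Fin r → R)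
    (M : Type v) [AddCommGroup M] [Module R M] :
    List.TFAE [
      IsProRegular M x,
      ∀ (F : Type (max u w)) [AddCommGroup F] [Module R F] [Module.Flat R F],
        IsProRegular (M ⊗[R] F) x,
      ∀ (I : Type (max u v w')) [AddCommGroup I] [Module R I] [Module.Injective R I] (i : Fin r),
        Subsingleton
          (cechCohomology (gammaSub (M →ₗ[R] I) (Fin.take i i.isLt.le x)) ![x i] 1),
      ∀ (I : Type (max u v w')) [AddCommGroup I] [Module R I] [Module.Injective R I] (i : Fin r),
        Subsingleton
          (cechCohomology (M →ₗ[R] I) (Fin.take (i + 1) (Nat.succ_le_of_lt i.isLt) x) 1)] := by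
  tfae_have 1 → 2 := fun H F _ _ _ i => (H i).colonTrans_tensor _ _
  tfae_have 2 → 1 := fun H i =>
    -- `R`, lifted to the required universe, is the flat module that recovers `M`.
    (H (ULift.{max u w} R) i).colonTrans_of_equiv _ _
      ((TensorProduct.congr (LinearEquiv.refl R M) ULift.moduleEquiv).trans (TensorProduct.rid R M))
  tfae_have 1 ↔ 3 :=
    ⟨fun H I _ _ _ i => (isProZero_iff_cechCohomology_gammaSub.{u, v, w'} _ _).1 (H i) I,
      fun H i => (isProZero_iff_cechCohomology_gammaSub.{u, v, w'} _ _).2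
        fun I _ _ _ => H I i⟩
  tfae_have 3 ↔ 4 :=
    ⟨fun H I _ _ _ => (subsingleton_cechCohomology_take_iff x).1 (H I),
      fun H I _ _ _ => (subsingleton_cechCohomology_take_iff x).2 (H I)⟩
  tfae_finish
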